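/- All graphs are finite and simple. A graph $H$ is an induced subgraph of $G$, written $H\prec G$, if $G$ has an induced subgraph isomorphic to $H$. For a (possibly infinite) family $\mathcal H$ of graphs, $G$ is $\mathcal H$-free if no $H\in\mathcal H$ satisfies $H\prec G$; and $\mathcal H_1\le\mathcal H_2$ means that for every $H_2\in\mathcal H_2$ there is $H_1\in\mathcal H_1$ with $H_1\prec H_2$. For a vertex $v$ let $N[v]$ be its closed neighborhood, and $N[S]=\bigcup_{v\in S}N[v]$. A set $S\subseteq V(G)$ is irredundant if $N[s]\setminus N[S\setminus\{s\}]\ne\emptyset$ for every $s\in S$. Put $\mathrm{IRS}(v)=\max\{|S| : S \text{ irredundant in } G,\ v\in S\}$ and let $\mathrm{IRS}(G)=\min\{\mathrm{IRS}(v): v\in V(G)\}$ be the irredundance saturation number of $G$. Let $B\text{-}\mathrm{IRS}$ be the class of all families $\mathcal H$ of graphs for which there is a constant $c$ with $\mathrm{IRS}(G)<c$ for every connected $\mathcal H$-free graph $G$ (connected graphs have at least one vertex). Let $P_n$ be the path on $n$ vertices and $K_{n,n}$ the complete bipartite graph with both parts of size $n$; let $K_{1,n}^*$ be obtained from the star $K_{1,n}$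 by adding a pendant vertex to every leaf, $K_n^*$ from the complete graph $K_n$ by adding a pendant vertex to every vertex, $CK_n$ from two disjoint copies of $K_n$ by adding a perfect matching between them, and $BS_n^p$ ($p\ge 2$) from two disjoint stars $K_{1,n}$ by connecting their centers by a path on $p$ vertices whose two ends are the centers. Theorem. Let $\mathcal H$ be a family of graphs. Then $\mathcal H\in B\text{-}\mathrm{IRS}$ if and only if there is an integer $n\ge 5$ with $$\mathcal H\le\{K_{1,n}^*,\,K_n^*,\,P_n,\,K_{n,n},\,CK_n\}\cup\{BS_n^p : 2\le p\le n-3\}.$$ -/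

import Mathlib

namespace DomRamsey

universe u v

/-- A finite simple graph. The vertex set may be empty. -/
structure FinGraph : Type (u + 1) where
  V : Type u
  finite : Finite V
  graph : SimpleGraph V

instance (G : FinGraph.{u}) : Finite G.V := G.finite

/-! ### Induced subgraphs and families -/

/-- `H` is (isomorphic to) an induced subgraph of `G`. -/
def FinGraph.IsInducedSubgraph (H : FinGraph.{u}) (G : FinGraph.{v}) : Prop :=
  H.graph.IsIndContained G.graph

/-- No member of the family is an induced subgraph of `G`. -/
def FinGraph.IsFree (G : FinGraph.{v}) (F : Set FinGraph.{u}) : Prop :=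
  ¬ ∃ H ∈ F, H.IsInducedSubgraph G

/-- `F₁ ≤ F₂`: every member of `F₂` has an induced subgraph in `F₁`. -/
def FamilyLE (F₁ : Set FinGraph.{u}) (F₂ : Set FinGraph.{v}) : Prop :=
  ∀ H₂ ∈ F₂, ∃ H₁ ∈ F₁, H₁.IsInducedSubgraph H₂

/-- The class `B-μ` of the families `F` such that `μ` is bounded on connected `F`-free graphs. -/
def BoundedClass (μ : FinGraph.{u} → ℕ) : Set (Set FinGraph.{u}) :=
  {F | ∃ c : ℕ, ∀ G : FinGraph.{u}, G.graph.Connected → G.IsFree F → μ G < c}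

/-! ### Irredundance saturation number -/

section Irredundance

variable {V : Type u} (G : SimpleGraph V)

/-- The closed neighborhood `N[v]`. -/
def closedNbhd (v : V) : Set V := insert v (G.neighborSet v)

/-- The closed neighborhood `N[S]` of a set of vertices. -/
def closedNbhdSet (S : Set V) : Set V := ⋃ v ∈ S, closedNbhd G v

/-- The private neighborhood `PN[v, S] = N[v] \ N[S \ {v}]`. -/
def privateNbhd (v : V) (S : Set V) : Set V :=
  closedNbhd G v \ closedNbhdSet G (S \ {v})

/-- Every vertex of `S` has a private neighbor with respect to `S`. -/
def IsIrredundant (S : Set V) : Prop :=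
  ∀ s ∈ S, (privateNbhd G s S).Nonempty

/-- The sizes of the irredundant sets that contain `v`. -/
def irredundantSizes (v : V) : Set ℕ :=
  {k | ∃ S : Set V, v ∈ S ∧ IsIrredundant G S ∧ S.ncard = k}

/-- `IRS(v)`: the maximum size of an irredundant set that contains `v`. -/
noncomputable def irsAt (v : V) : ℕ := sSup (irredundantSizes G v)

/-- In a finite graph the maximum that defines `IRS(v)` exists. -/
theorem irsAt_isGreatest [Finite V] (v : V) :
    IsGreatest (irredundantSizes G v) (irsAt G v) := by
  have hne : (irredundantSizes G v).Nonempty := by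
    refine ⟨_, {v}, rfl, ?_, rfl⟩
    intro s hs
    rw [Set.mem_singleton_iff] at hs
    subst hs
    exact ⟨s, by simp [privateNbhd, closedNbhd, closedNbhdSet]⟩
  have hb : BddAbove (irredundantSizes G v) := by
    refine ⟨Nat.card V, ?_⟩
    rintro k ⟨S, -, -, rfl⟩
    exact Set.ncard_le_card S
  exact ⟨Nat.sSup_mem hne hb, fun k hk => le_csSup hb hk⟩

end Irredundance

/-- The irredundance saturation number `IRS(G) = min {IRS(v) : v ∈ V}`. -/
noncomputable def irs (G : FinGraph.{u}) : ℕ := sInf (Set.range (irsAt G.graph))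

/-- For a graph with at least one vertex the minimum that defines `IRS(G)` exists. -/
theorem irs_isLeast (G : FinGraph.{u}) [Nonempty G.V] :
    IsLeast (Set.range (irsAt G.graph)) (irs G) :=
  ⟨Nat.sInf_mem (Set.range_nonempty _), fun _ hk => Nat.sInf_le hk⟩

/-! ### The special graphs -/

/-- The graph obtained from `G` by adding, for every vertex `a` of `A`, one new vertex whose
only neighbor is `a`. -/
def addPendants {V : Type u} (G : SimpleGraph V) (A : Set V) : SimpleGraph (V ⊕ A) where
  Adj
    | .inl a, .inl b => G.Adj a b
    | .inl a, .inr b => a = b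
    | .inr a, .inl b => b = a
    | .inr _, .inr _ => False
  symm := ⟨by
    rintro (a | a) (b | b) h
    · exact SimpleGraph.Adj.symm h
    · exact h
    · exact h
    · exact h⟩
  loopless := ⟨by
    rintro (a | a) h
    · exact G.irrefl h
    · exact h⟩

/-- `K_{1,n}^*`: the star `K_{1,n}` with a pendant vertex added to every leaf. -/
def starPendant (n : ℕ) : FinGraph.{0} where
  V := (Fin 1 ⊕ Fin n) ⊕ (Set.range (Sum.inr : Fin n → Fin 1 ⊕ Fin n))
  finite := inferInstance
  graph := addPendants (completeBipartiteGraph (Fin 1) (Fin n)) (Set.range Sum.inr)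

/-- `K_n^*`: the complete graph `K_n` with a pendant vertex added to every vertex. -/
def completePendant (n : ℕ) : FinGraph.{0} where
  V := Fin n ⊕ (Set.univ : Set (Fin n))
  finite := inferInstance
  graph := addPendants (⊤ : SimpleGraph (Fin n)) Set.univ

/-- The path `P_n` on `n` vertices. -/
def path (n : ℕ) : FinGraph.{0} where
  V := Fin n
  finite := inferInstance
  graph := SimpleGraph.pathGraph n

/-- The complete bipartite graph `K_{n,n}`. -/
def completeBip (n : ℕ) : FinGraph.{0} where
  V := Fin n ⊕ Fin n
  finite := inferInstance
  graph := completeBipartiteGraph (Fin n) (Fin n)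

/-- Two disjoint copies of the complete graph on `Fin n`, joined by the perfect matching of
corresponding vertices. -/
def coupledGraph (n : ℕ) : SimpleGraph (Fin n ⊕ Fin n) where
  Adj
    | .inl a, .inl b => a ≠ b
    | .inl a, .inr b => a = b
    | .inr a, .inl b => a = b
    | .inr a, .inr b => a ≠ b
  symm := ⟨by rintro (a | a) (b | b) h <;> exact h.symm⟩
  loopless := ⟨by rintro (a | a) h <;> exact h rfl⟩

/-- `CK_n`. -/
def coupledComplete (n : ℕ) : FinGraph.{0} where
  V := Fin n ⊕ Fin n
  finite := inferInstance
  graph := coupledGraph n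

/-- The path `P_p` with `n` pendant vertices (leaves) attached to its first vertex and `n`
pendant vertices attached to its last vertex. -/
def bistarGraph (n p : ℕ) : SimpleGraph (Fin p ⊕ (Fin n ⊕ Fin n)) where
  Adj
    | .inl i, .inl j => (SimpleGraph.pathGraph p).Adj i j
    | .inl i, .inr (.inl _) => i.val = 0
    | .inl i, .inr (.inr _) => i.val + 1 = p
    | .inr (.inl _), .inl i => i.val = 0
    | .inr (.inr _), .inl i => i.val + 1 = p
    | .inr _, .inr _ => False
  symm := ⟨by
    rintro (i | a | a) (j | b | b) h
    · exact SimpleGraph.Adj.symm h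
    all_goals exact h⟩
  loopless := ⟨by
    rintro (i | a | a) h
    · exact (SimpleGraph.pathGraph p).irrefl h
    all_goals exact h⟩

/-- `BS_n^p`: two disjoint stars `K_{1,n}` whose centers are connected by a path on `p`
vertices (the two centers are the ends of the path). -/
def bistar (n p : ℕ) : FinGraph.{0} where
  V := Fin p ⊕ (Fin n ⊕ Fin n)
  finite := inferInstance
  graph := bistarGraph n p

/-- `{K_{1,n}^*, K_n^*, P_n, K_{n,n}, CK_n} ∪ {BS_n^p : 2 ≤ p ≤ n - 3}`. -/
def irsFamily (n : ℕ) : Set FinGraph.{0} :=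
  {starPendant n, completePendant n, path n, completeBip n, coupledComplete n} ∪
    {H | ∃ p : ℕ, 2 ≤ p ∧ p + 3 ≤ n ∧ H = bistar n p}

end DomRamsey

/-!
If every `irsFamily n` has a member without an induced subgraph in `F`, then `irs` is unbounded on
the connected `F`-free graphs, because all members of `irsFamily (2 * c + 5)` are connected and each
of their vertices lies in an irredundant set of size `c` (`irsFamily_large`). These sets are
independent, except for one copy of `K_n` in `K_n^*` and in `CK_n`.

Conversely, let `G` be connected without the special graphs of index `n`, and suppose that `irs G`
is huge. By Ramsey's theorem the private neighbours of a large irredundant set through `w` contain a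
large independent set outside `N[w]`, since otherwise `K_n^*` or `CK_n` appears
(`exists_indepSet_of_le_irsAt`). As `P_n` is not induced, the distances from `w` are bounded, so
this independent set can be pulled towards `w` level by level. Its vertices either accumulate as
neighbours of one vertex, or are dominated by many vertices with private neighbours; the second
alternative, repeated on every level, ends in a `K_n^*` or a `K_{1,n}^*`
(`exists_star_or_indMatching`, `exists_bound_indMatching_levels`). Hence from every `w` there is a
vertex `x ≠ w` with a large independent set `Z` of neighbours, all of them one level further from
`w` than `x` (`exists_star_levels`).

Now choose `w` and an independent set `Y ⊆ N(w)` with `|Y|` maximal. This extremal choice decides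
how `Y` attaches to a geodesic from `w` to `x` (`exists_irsAt_lt`). If many members of `Y` have the
same last neighbour on the geodesic, and this neighbour is not `x`, then there is a `K_{n,n}` or a
bistar `BS_n^p`, which contains `P_n` when `p` is too large to be listed in the family. Otherwise
almost all of `Y` lies in `N(x)`, and, unless there is a large matching between `Y` and `Z`,
deleting few vertices from `Y ∪ Z` leaves an independent set in `N(x)` that is larger than `Y`. A
large matching contains a large induced matching, which forms a `K_{1,n}^*` with `w`, or it forces a
`K_{n,n}` (`exists_parallel_subsequence`).
-/

namespace DomRamsey

universe u v

/-! ### Ramsey's theorem for pairs -/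

/-- Two-colour Ramsey theorem for a relation on increasing pairs of a finite set of naturals. -/
theorem exists_ramsey_subset (a b : ℕ) : ∃ N : ℕ, ∀ (s : Finset ℕ) (r : ℕ → ℕ → Prop),
    N ≤ s.card → (∃ t ⊆ s, t.card = a ∧ ∀ i ∈ t, ∀ j ∈ t, i < j → r i j) ∨
      ∃ t ⊆ s, t.card = b ∧ ∀ i ∈ t, ∀ j ∈ t, i < j → ¬ r i j := by
  classical
  induction a generalizing b with
  | zero => exact ⟨0, fun s r _ => Or.inl ⟨∅, by simp⟩⟩
  | succ a iha =>
    induction b with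
    | zero => exact ⟨0, fun s r _ => Or.inr ⟨∅, by simp⟩⟩
    | succ b ihb =>
      obtain ⟨N₁, h₁⟩ := iha (b + 1)
      obtain ⟨N₂, h₂⟩ := ihb
      refine ⟨N₁ + N₂ + 1, fun s r hs => ?_⟩
      have hne : s.Nonempty := Finset.card_pos.1 (by omega)
      -- Split the remaining elements by their colour with respect to the least element.
      set m := s.min' hne with hm
      have hms : m ∈ s := s.min'_mem hne
      have hlt : ∀ x ∈ s.erase m, m < x := fun x hx => by
        have := s.min'_le x (Finset.mem_of_mem_erase hx)
        exact lt_of_le_of_ne this (Finset.ne_of_mem_erase hx).symm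
      have hcard : (s.erase m).card + 1 = s.card := Finset.card_erase_add_one hms
      have hsplit := Finset.card_filter_add_card_filter_not (s := s.erase m) (fun x => r m x)
      have hsub : ∀ p : ℕ → Prop, [DecidablePred p] → (s.erase m).filter p ⊆ s := fun p _ =>
        (Finset.filter_subset _ _).trans (Finset.erase_subset _ _)
      rcases le_or_gt N₁ ((s.erase m).filter (fun x => r m x)).card with h | h
      · rcases h₁ _ r h with ⟨t, ht, hc, hr⟩ | ⟨t, ht, hc, hr⟩
        · have hmt : m ∉ t := fun hmt =>
            (Finset.notMem_erase m s) (Finset.mem_of_mem_filter _ (ht hmt))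
          refine Or.inl ⟨insert m t, Finset.insert_subset hms (ht.trans (hsub _)), by
            rw [Finset.card_insert_of_notMem hmt, hc], ?_⟩
          intro i hi j hj hij
          rw [Finset.mem_insert] at hi hj
          rcases hi with rfl | hi <;> rcases hj with rfl | hj
          · omega
          · exact (Finset.mem_filter.1 (ht hj)).2
          · have := hlt i (Finset.mem_of_mem_filter _ (ht hi)); omega
          · exact hr i hi j hj hij
        · exact Or.inr ⟨t, ht.trans (hsub _), hc, hr⟩
      · rcases h₂ ((s.erase m).filter (fun x => ¬ r m x)) r (by omega) with
          ⟨t, ht, hc, hr⟩ | ⟨t, ht, hc, hr⟩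
        · exact Or.inl ⟨t, ht.trans (hsub _), hc, hr⟩
        · have hmt : m ∉ t := fun hmt =>
            (Finset.notMem_erase m s) (Finset.mem_of_mem_filter _ (ht hmt))
          refine Or.inr ⟨insert m t, Finset.insert_subset hms (ht.trans (hsub _)), by
            rw [Finset.card_insert_of_notMem hmt, hc], ?_⟩
          intro i hi j hj hij
          rw [Finset.mem_insert] at hi hj
          rcases hi with rfl | hi <;> rcases hj with rfl | hj
          · omega
          · exact (Finset.mem_filter.1 (ht hj)).2
          · have := hlt i (Finset.mem_of_mem_filter _ (ht hi)); omega
          · exact hr i hi j hj hij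

/-- Two-colour Ramsey theorem on increasing pairs of `Fin N`, with the homogeneous set given as
an increasing sequence. -/
theorem exists_ramsey (n : ℕ) : ∃ N : ℕ, ∀ r : Fin N → Fin N → Prop, ∃ g : Fin n ↪o Fin N,
    (∀ i j, i < j → r (g i) (g j)) ∨ ∀ i j, i < j → ¬ r (g i) (g j) := by
  obtain ⟨N, hN⟩ := exists_ramsey_subset n n
  refine ⟨N, fun r => ?_⟩
  have key : ∀ t ⊆ Finset.range N, ∀ ht : t.card = n, ∃ g : Fin n ↪o Fin N,
      ∀ i, ((g i : Fin N) : ℕ) ∈ t := fun t hts ht =>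
    ⟨OrderEmbedding.ofStrictMono
        (fun i => ⟨t.orderEmbOfFin ht i, Finset.mem_range.1 (hts (t.orderEmbOfFin_mem ht i))⟩)
        (fun i j hij => by simpa using hij),
      fun i => t.orderEmbOfFin_mem ht i⟩
  rcases hN (Finset.range N) (fun i j => ∃ (hi : i < N) (hj : j < N), r ⟨i, hi⟩ ⟨j, hj⟩)
    (by simp) with ⟨t, hts, ht, hr⟩ | ⟨t, hts, ht, hr⟩
  · obtain ⟨g, hg⟩ := key t hts ht
    refine ⟨g, Or.inl fun i j hij => ?_⟩
    obtain ⟨_, _, h⟩ := hr _ (hg i) _ (hg j) (Fin.lt_def.1 (g.strictMono hij))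
    exact h
  · obtain ⟨g, hg⟩ := key t hts ht
    exact ⟨g, Or.inr fun i j hij h =>
      hr _ (hg i) _ (hg j) (Fin.lt_def.1 (g.strictMono hij)) ⟨(g i).2, (g j).2, h⟩⟩

/-- Ramsey's theorem for graphs: a long sequence of vertices has a long subsequence whose terms are
either pairwise adjacent or pairwise non-adjacent. -/
theorem exists_ramsey_graph (n : ℕ) : ∃ N : ℕ, ∀ {V : Type u} (G : SimpleGraph V) (a : Fin N → V),
    ∃ g : Fin n ↪o Fin N, (∀ i j, i ≠ j → G.Adj (a (g i)) (a (g j))) ∨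
      ∀ i j, ¬ G.Adj (a (g i)) (a (g j)) := by
  obtain ⟨N, hN⟩ := exists_ramsey n
  refine ⟨N, fun G a => ?_⟩
  obtain ⟨g, hg | hg⟩ := hN (fun i j => G.Adj (a i) (a j))
  · refine ⟨g, Or.inl fun i j hij => ?_⟩
    rcases lt_or_gt_of_ne hij with h | h
    · exact hg i j h
    · exact (hg j i h).symm
  · refine ⟨g, Or.inr fun i j => ?_⟩
    rcases lt_trichotomy i j with h | rfl | h
    · exact hg i j h
    · exact G.irrefl
    · exact fun h' => hg j i h h'.symm

/-! ### Recognizing the special graphs -/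

section Recognition

variable {V : Type u} {G : SimpleGraph V} {n : ℕ}

theorem isIndContained_of_adj_iff {W : Type*} {H : SimpleGraph W} (f : W → V)
    (hf : Function.Injective f) (h : ∀ a b, G.Adj (f a) (f b) ↔ H.Adj a b) :
    H.IsIndContained G :=
  ⟨⟨⟨f, hf⟩, fun {a b} => h a b⟩⟩

theorem completePendant_isIndContained {a b : Fin n → V}
    (ha : ∀ i j, i ≠ j → G.Adj (a i) (a j)) (hb : ∀ i j, ¬ G.Adj (b i) (b j))
    (hab : ∀ i j, G.Adj (a i) (b j) ↔ i = j) :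
    (completePendant n).graph.IsIndContained G := by
  have hne : ∀ i j, a i ≠ b j := fun i j h => hb i j (h ▸ ((hab i i).2 rfl).symm)
  refine isIndContained_of_adj_iff (fun x : Fin n ⊕ (Set.univ : Set (Fin n)) =>
    Sum.elim a (fun i => b i.1) x) ?_ ?_
  · rintro (i | ⟨i, _⟩) (j | ⟨j, _⟩) h
    · by_contra hij
      exact (ha i j fun h' => hij (h' ▸ rfl)).ne h
    · exact (hne _ _ h).elim
    · exact (hne _ _ h.symm).elim
    · have h : b i = b j := h
      have := (hab i j).1 (h ▸ (hab i i).2 rfl)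
      subst this; rfl
  · rintro (i | ⟨i, _⟩) (j | ⟨j, _⟩)
    · exact ⟨fun h h' => G.irrefl (h' ▸ h : G.Adj (a j) (a j)), ha i j⟩
    · exact hab i j
    · exact (G.adj_comm _ _).trans (hab j i)
    · exact ⟨fun h => hb i j h, fun h => h.elim⟩

theorem starPendant_isIndContained {w : V} {a b : Fin n → V}
    (hwa : ∀ i, G.Adj w (a i)) (hwb : ∀ i, ¬ G.Adj w (b i)) (hne : ∀ i, w ≠ b i)
    (ha : ∀ i j, ¬ G.Adj (a i) (a j)) (hb : ∀ i j, ¬ G.Adj (b i) (b j))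
    (hab : ∀ i j, G.Adj (a i) (b j) ↔ i = j) :
    (starPendant n).graph.IsIndContained G := by
  have hab' : ∀ i j, a i ≠ b j := fun i j h => hwb j (h ▸ hwa i)
  have hai : Function.Injective a := fun i j h => by
    exact ((hab j i).1 (h ▸ (hab i i).2 rfl)).symm
  have hbi : Function.Injective b := fun i j h => by
    exact (hab i j).1 (h ▸ (hab i i).2 rfl)
  refine isIndContained_of_adj_iff
    (fun x : (Fin 1 ⊕ Fin n) ⊕ (Set.range (Sum.inr : Fin n → Fin 1 ⊕ Fin n)) =>
      Sum.elim (Sum.elim (fun _ => w) a) (fun i => Sum.elim (fun _ => w) b i.1) x) ?_ ?_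
  · rintro ((i | i) | ⟨_, i, rfl⟩) ((j | j) | ⟨_, j, rfl⟩) h
    · rw [Subsingleton.elim i j]
    · exact ((hwa j).ne h).elim
    · exact (hne _ h).elim
    · exact ((hwa i).ne h.symm).elim
    · rw [hai h]
    · exact (hab' _ _ h).elim
    · exact (hne _ h.symm).elim
    · exact (hab' _ _ h.symm).elim
    · have : i = j := hbi h
      subst this; rfl
  · rintro ((i | i) | ⟨_, i, rfl⟩) ((j | j) | ⟨_, j, rfl⟩)
    · simp [starPendant, addPendants]
    · simpa [starPendant, addPendants] using hwa j
    · simpa [starPendant, addPendants] using hwb j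
    · simpa [starPendant, addPendants] using (hwa i).symm
    · simpa [starPendant, addPendants] using ha i j
    · simpa [starPendant, addPendants] using hab i j
    · simpa [starPendant, addPendants] using fun h => hwb i (G.adj_symm h)
    · simpa [starPendant, addPendants, G.adj_comm] using hab j i
    · simpa [starPendant, addPendants] using hb i j

theorem completeBip_isIndContained {a b : Fin n → V} (hai : Function.Injective a)
    (hbi : Function.Injective b) (ha : ∀ i j, ¬ G.Adj (a i) (a j))
    (hb : ∀ i j, ¬ G.Adj (b i) (b j)) (hab : ∀ i j, G.Adj (a i) (b j)) :
    (completeBip n).graph.IsIndContained G := by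
  refine isIndContained_of_adj_iff (fun x : Fin n ⊕ Fin n => Sum.elim a b x) ?_ ?_
  · rintro (i | i) (j | j) h
    · exact congrArg _ (hai h)
    · exact ((hab i j).ne h).elim
    · exact ((hab j i).ne h.symm).elim
    · exact congrArg _ (hbi h)
  · rintro (i | i) (j | j)
    · simpa [completeBip] using ha i j
    · simpa [completeBip] using hab i j
    · simpa [completeBip] using (hab j i).symm
    · simpa [completeBip] using hb i j

theorem coupledComplete_isIndContained {a b : Fin n → V}
    (ha : ∀ i j, i ≠ j → G.Adj (a i) (a j)) (hb : ∀ i j, i ≠ j → G.Adj (b i) (b j))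
    (hab : ∀ i j, G.Adj (a i) (b j) ↔ i = j) (hne : ∀ i j, a i ≠ b j) :
    (coupledComplete n).graph.IsIndContained G := by
  refine isIndContained_of_adj_iff (fun x : Fin n ⊕ Fin n => Sum.elim a b x) ?_ ?_
  · rintro (i | i) (j | j) h
    · by_contra hij
      exact (ha i j fun h' => hij (h' ▸ rfl)).ne h
    · exact (hne _ _ h).elim
    · exact (hne _ _ h.symm).elim
    · by_contra hij
      exact (hb i j fun h' => hij (h' ▸ rfl)).ne h
  · rintro (i | i) (j | j)
    · exact ⟨fun h h' => G.irrefl (h' ▸ h : G.Adj (a j) (a j)), ha i j⟩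
    · exact hab i j
    · exact (G.adj_comm _ _).trans ((hab j i).trans eq_comm)
    · exact ⟨fun h h' => G.irrefl (h' ▸ h : G.Adj (b j) (b j)), hb i j⟩

theorem bistar_isIndContained {p : ℕ} (hp : 2 ≤ p) {f : Fin p → V} {y z : Fin n → V}
    (hfi : Function.Injective f)
    (hf : ∀ i j, G.Adj (f i) (f j) ↔ (SimpleGraph.pathGraph p).Adj i j)
    (hyi : Function.Injective y) (hzi : Function.Injective z)
    (hy : ∀ i j, ¬ G.Adj (y i) (y j)) (hz : ∀ i j, ¬ G.Adj (z i) (z j))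
    (hyz : ∀ i j, ¬ G.Adj (y i) (z j)) (hfy : ∀ i j, G.Adj (f i) (y j) ↔ i.val = 0)
    (hfz : ∀ i j, G.Adj (f i) (z j) ↔ i.val + 1 = p) :
    (bistar n p).graph.IsIndContained G := by
  have hyz' : ∀ i j, y i ≠ z j := fun i j h => by
    have h0 := (hfy ⟨0, by omega⟩ i).2 rfl
    rw [h, hfz] at h0
    simp only at h0
    omega
  have hfy' : ∀ i j, f i ≠ y j := fun i j h => by
    by_cases hi : i.val + 1 = p
    · exact hyz j j (h ▸ (hfz i j).2 hi)
    · have := (hf ⟨i + 1, by omega⟩ i).2 (by simp [SimpleGraph.pathGraph_adj])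
      rw [h, hfy] at this
      simp at this
  have hfz' : ∀ i j, f i ≠ z j := fun i j h => by
    by_cases hi : i.val = 0
    · exact hyz j j (h ▸ ((hfy i j).2 hi).symm)
    · have := (hf ⟨i - 1, by omega⟩ i).2 (by simp [SimpleGraph.pathGraph_adj]; omega)
      rw [h, hfz] at this
      simp only at this
      omega
  refine isIndContained_of_adj_iff (fun x : Fin p ⊕ (Fin n ⊕ Fin n) =>
    Sum.elim f (Sum.elim y z) x) ?_ ?_
  · rintro (i | i | i) (j | j | j) h
    · exact congrArg _ (hfi h)
    · exact (hfy' _ _ h).elim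
    · exact (hfz' _ _ h).elim
    · exact (hfy' _ _ h.symm).elim
    · exact congrArg _ (congrArg _ (hyi h))
    · exact (hyz' _ _ h).elim
    · exact (hfz' _ _ h.symm).elim
    · exact (hyz' _ _ h.symm).elim
    · exact congrArg _ (congrArg _ (hzi h))
  · rintro (i | i | i) (j | j | j)
    · exact hf i j
    · exact hfy i j
    · exact hfz i j
    · exact (G.adj_comm _ _).trans (hfy j i)
    · exact ⟨fun h => hy i j h, fun h => h.elim⟩
    · exact ⟨fun h => hyz i j h, fun h => h.elim⟩
    · exact (G.adj_comm _ _).trans (hfz j i)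
    · exact ⟨fun h => hyz j i h.symm, fun h => h.elim⟩
    · exact ⟨fun h => hz i j h, fun h => h.elim⟩

/-- The path through both centres of a bistar, extended by a leaf at each end, has `p + 2`
vertices. -/
theorem path_isIndContained_bistar {p : ℕ} (hp : 0 < p) (hn : 0 < n) (h : n ≤ p + 2) :
    (path n).graph.IsIndContained (bistar n p).graph := by
  change (SimpleGraph.pathGraph n).IsIndContained (bistarGraph n p)
  refine isIndContained_of_adj_iff (fun i : Fin n =>
    if h0 : i.val = 0 then (Sum.inr (Sum.inl ⟨0, hn⟩) : Fin p ⊕ (Fin n ⊕ Fin n))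
    else if hp : i.val ≤ p then Sum.inl ⟨i.val - 1, by omega⟩
    else Sum.inr (Sum.inr ⟨0, hn⟩)) ?_ ?_
  · intro i j hij
    have hi := i.2
    have hj := j.2
    apply Fin.ext
    dsimp only at hij
    split_ifs at hij <;> simp at hij <;> omega
  · intro i j
    have hi := i.2
    have hj := j.2
    rw [SimpleGraph.pathGraph_adj]
    split_ifs <;> simp [bistarGraph, SimpleGraph.pathGraph_adj] <;> omega

end Recognition

/-! ### Matchings and domination -/

theorem exists_injective_of_le_card {α : Type*} {n : ℕ} {s : Finset α} (h : n ≤ s.card) :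
    ∃ y : Fin n → α, Function.Injective y ∧ ∀ i, y i ∈ s :=
  ⟨fun i => (s.equivFin.symm (Fin.castLE h i)).1,
    fun i j hij => by simpa using Subtype.ext hij, fun i => (s.equivFin.symm _).2⟩

/-- Greedy matching: if no `k` disjoint `r`-related pairs exist between `Y` and `Z`, then deleting
at most `k` elements from each side destroys all related pairs. -/
theorem exists_matching_or_unrelated {α : Type*} (r : α → α → Prop) (Y Z : Finset α) (k : ℕ) :
    (∃ y z : Fin k → α, Function.Injective y ∧ Function.Injective z ∧ (∀ i, y i ∈ Y) ∧
      (∀ i, z i ∈ Z) ∧ ∀ i, r (y i) (z i)) ∨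
    ∃ Y' ⊆ Y, ∃ Z' ⊆ Z, Y.card ≤ Y'.card + k ∧ Z.card ≤ Z'.card + k ∧
      ∀ y ∈ Y', ∀ z ∈ Z', ¬ r y z := by
  classical
  induction k with
  | zero => exact Or.inl ⟨Fin.elim0, Fin.elim0, fun i => i.elim0, fun i => i.elim0,
      fun i => i.elim0, fun i => i.elim0, fun i => i.elim0⟩
  | succ k ih =>
    rcases ih with ⟨y, z, hy, hz, hyY, hzZ, hr⟩ | ⟨Y', hY', Z', hZ', h₁, h₂, h₃⟩
    · by_cases hex : ∃ a ∈ Y \ Finset.univ.image y, ∃ b ∈ Z \ Finset.univ.image z, r a b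
      · obtain ⟨a, ha, b, hb, hab⟩ := hex
        simp only [Finset.mem_sdiff, Finset.mem_image, Finset.mem_univ, true_and] at ha hb
        refine Or.inl ⟨Fin.cons a y, Fin.cons b z, Fin.cons_injective_iff.2 ⟨ha.2, hy⟩,
          Fin.cons_injective_iff.2 ⟨hb.2, hz⟩, ?_, ?_, ?_⟩ <;> refine Fin.cases ?_ ?_
        · exact ha.1
        · exact hyY
        · exact hb.1
        · exact hzZ
        · exact hab
        · exact hr
      · push Not at hex
        have hc : ∀ f : Fin k → α, (Finset.univ.image f).card ≤ k := fun f => by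
          simpa using Finset.card_image_le (s := Finset.univ) (f := f)
        refine Or.inr ⟨_, Finset.sdiff_subset, _, Finset.sdiff_subset, ?_, ?_, hex⟩
        · have := Finset.le_card_sdiff (Finset.univ.image y) Y
          have := hc y
          omega
        · have := Finset.le_card_sdiff (Finset.univ.image z) Z
          have := hc z
          omega
    · exact Or.inr ⟨Y', hY', Z', hZ', by omega, by omega, h₃⟩

/-- An induced matching with edges `a i`–`b i` whose two sides are independent. -/
structure IsIndMatching {V : Type u} (G : SimpleGraph V) {k : ℕ} (a b : Fin k → V) : Prop where
  left : ∀ i j, ¬ G.Adj (a i) (a j)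
  right : ∀ i j, ¬ G.Adj (b i) (b j)
  adj_iff : ∀ i j, G.Adj (a i) (b j) ↔ i = j

theorem IsIndMatching.left_injective {V : Type u} {G : SimpleGraph V} {k : ℕ} {a b : Fin k → V}
    (h : IsIndMatching G a b) : Function.Injective a := fun i j hij =>
  ((h.adj_iff j i).1 (hij ▸ (h.adj_iff i i).2 rfl)).symm

/-- Two long sequences of independent vertices, indexed in parallel, have parallel subsequences with
no edges between terms of different indices, unless a large `K_{n,n}` is induced. -/
theorem exists_parallel_subsequence (n : ℕ) : ∃ k : ℕ, ∀ {V : Type u} {G : SimpleGraph V}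
    {y z : Fin k → V}, Function.Injective y → Function.Injective z →
    (∀ i j, ¬ G.Adj (y i) (y j)) → (∀ i j, ¬ G.Adj (z i) (z j)) →
    ¬ (completeBip n).graph.IsIndContained G →
    ∃ g : Fin (n + n) ↪o Fin k, ∀ i j, i ≠ j → ¬ G.Adj (y (g i)) (z (g j)) := by
  obtain ⟨k₁, h₁⟩ := exists_ramsey (n + n)
  obtain ⟨k, h₂⟩ := exists_ramsey k₁
  refine ⟨k, fun {V G y z} hyi hzi hy hz hK => ?_⟩
  have hlt : ∀ i j : Fin n, Fin.castAdd n i < Fin.natAdd n j := fun i j => by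
    rw [Fin.lt_def]; simp only [Fin.val_castAdd, Fin.val_natAdd]; omega
  -- The first `n` terms of one sequence and the last `n` terms of the other span a `K_{n,n}`.
  obtain ⟨g, hg⟩ := h₂ (fun i j => G.Adj (y i) (z j))
  obtain ⟨g', hg'⟩ := h₁ (fun i j => G.Adj (z (g i)) (y (g j)))
  rcases hg with hg | hg
  · exact (hK (completeBip_isIndContained (a := fun i => y (g (g' (Fin.castAdd n i))))
      (b := fun i => z (g (g' (Fin.natAdd n i))))
      (fun i j h => by simpa using hyi h) (fun i j h => by simpa using hzi h)
      (fun i j => hy _ _) (fun i j => hz _ _)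
      (fun i j => hg _ _ (g'.strictMono (hlt i j))))).elim
  rcases hg' with hg' | hg'
  · exact (hK (completeBip_isIndContained (a := fun i => z (g (g' (Fin.castAdd n i))))
      (b := fun i => y (g (g' (Fin.natAdd n i))))
      (fun i j h => by simpa using hzi h) (fun i j h => by simpa using hyi h)
      (fun i j => hz _ _) (fun i j => hy _ _)
      (fun i j => hg' _ _ (hlt i j)))).elim
  refine ⟨g'.trans g, fun i j hij => ?_⟩
  rcases lt_or_gt_of_ne hij with h | h
  · exact hg _ _ (g'.strictMono h)
  · exact fun h' => hg' _ _ h h'.symm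

/-- If `L` dominates the independent set `I`, then some vertex of `L` has many neighbours in `I`,
or there is a large induced matching from an independent part of `L` to `I`. A minimal dominating
subset of `L` provides the private neighbours that form the matching. -/
theorem exists_star_or_indMatching (n m k : ℕ) : ∃ N : ℕ, ∀ {V : Type u} {G : SimpleGraph V}
    [Finite V] [DecidableRel G.Adj],
    ¬ (completePendant n).graph.IsIndContained G →
    ∀ (L : Set V) (I : Finset V), N ≤ I.card → G.IsIndepSet (I : Set V) →
    (∀ v ∈ I, ∃ x ∈ L, G.Adj x v) →
    (∃ x ∈ L, m ≤ (I.filter (G.Adj x)).card) ∨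
      ∃ a b : Fin k → V, (∀ i, a i ∈ L) ∧ (∀ i, b i ∈ I) ∧ IsIndMatching G a b := by
  classical
  obtain ⟨q, hq⟩ := exists_ramsey_graph.{u} (n + k)
  -- A dominating set in which every vertex has fewer than `m` neighbours in `I` has at
  -- least `q` elements.
  refine ⟨q * (m + 1), fun {V G} _ _ hK L I hI hind hdom => ?_⟩
  have := Fintype.ofFinite V
  by_cases hm : ∃ x ∈ L, m ≤ (I.filter (G.Adj x)).card
  · exact Or.inl hm
  push Not at hm
  right
  have hindep : ∀ x ∈ I, ∀ y ∈ I, ¬ G.Adj x y := fun x hx y hy h => hind hx hy h.ne h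
  obtain ⟨D, hD⟩ := (Finset.univ.filter (fun D : Finset V =>
    (D : Set V) ⊆ L ∧ ∀ v ∈ I, ∃ x ∈ D, G.Adj x v)).exists_minimal
      ⟨Finset.univ.filter (· ∈ L), by
        simp only [Finset.mem_filter, Finset.mem_univ, true_and]
        exact ⟨fun x hx => by simpa using hx, hdom⟩⟩
  have hmin := hD.2
  have hDp := hD.1
  simp only [Finset.mem_filter, Finset.mem_univ, true_and] at hmin hDp
  obtain ⟨hDL, hDdom⟩ := hDp
  have hpriv : ∀ d ∈ D, ∃ v ∈ I, ∀ x ∈ D, G.Adj x v ↔ x = d := by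
    intro d hd
    by_contra! hcon
    have := @hmin (D.erase d) ⟨fun x hx => hDL (Finset.mem_of_mem_erase hx), fun v hv => by
      obtain ⟨x, hx, hxv⟩ := hDdom v hv
      by_cases hxd : x = d
      · subst hxd
        obtain ⟨x', hx', h | h⟩ := hcon v hv
        · exact ⟨x', Finset.mem_erase.2 ⟨h.2, hx'⟩, h.1⟩
        · exact (h.1 (h.2 ▸ hxv)).elim
      · exact ⟨x, Finset.mem_erase.2 ⟨hxd, hx⟩, hxv⟩⟩ (Finset.erase_subset _ _)
    exact Finset.notMem_erase d D (this hd)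
  have hcard : q ≤ D.card := by
    by_contra! hlt
    have h1 : I ⊆ D.biUnion (fun x => I.filter (G.Adj x)) := fun v hv => by
      obtain ⟨x, hx, hxv⟩ := hDdom v hv
      exact Finset.mem_biUnion.2 ⟨x, hx, Finset.mem_filter.2 ⟨hv, hxv⟩⟩
    have h2 : I.card ≤ ∑ x ∈ D, (I.filter (G.Adj x)).card :=
      (Finset.card_le_card h1).trans Finset.card_biUnion_le
    have h3 : ∑ x ∈ D, (I.filter (G.Adj x)).card ≤ D.card * (m + 1) :=
      Finset.sum_le_card_nsmul _ _ _ fun x hx => (hm x (hDL hx)).le.trans m.le_succ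
    have : D.card * (m + 1) < q * (m + 1) := Nat.mul_lt_mul_of_pos_right hlt m.succ_pos
    omega
  choose p hpI hp using hpriv
  obtain ⟨y, hy, hyD⟩ := exists_injective_of_le_card hcard
  obtain ⟨g, hg⟩ := hq G y
  have hadj : ∀ i j, G.Adj (y i) (p (y j) (hyD j)) ↔ i = j := fun i j =>
    (hp _ (hyD j) _ (hyD i)).trans hy.eq_iff
  rcases hg with hg | hg
  · exact (hK (completePendant_isIndContained (a := fun i => y (g (Fin.castAdd k i)))
      (b := fun i => p _ (hyD (g (Fin.castAdd k i))))
      (fun i j hij => hg _ _ (by simpa using hij)) (fun i j => hindep _ (hpI _ _) _ (hpI _ _))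
      (fun i j => (hadj _ _).trans (by simp)))).elim
  · exact ⟨fun i => y (g (Fin.natAdd n i)), fun i => p _ (hyD (g (Fin.natAdd n i))),
      fun i => hDL (hyD _), fun i => hpI _ _, fun i j => hg _ _,
      fun i j => hindep _ (hpI _ _) _ (hpI _ _), fun i j => (hadj _ _).trans (by simp)⟩

/-! ### Distance levels -/

section Levels

variable {V : Type u} {G : SimpleGraph V}

/-- The vertices `x 0, x 1, …, x e` form a shortest path starting at `r = x 0`. -/
structure IsGeodesic (G : SimpleGraph V) (r : V) (x : ℕ → V) (e : ℕ) : Prop where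
  dist_eq : ∀ i ≤ e, G.dist r (x i) = i
  adj : ∀ i < e, G.Adj (x i) (x (i + 1))

theorem exists_adj_of_dist_eq_succ (hG : G.Connected) {r v : V} {d : ℕ}
    (h : G.dist r v = d + 1) : ∃ u, G.dist r u = d ∧ G.Adj u v := by
  obtain ⟨p, hp⟩ := hG.exists_walk_length_eq_dist v r
  cases p with
  | nil => simp at h
  | @cons _ u _ huv q =>
    refine ⟨u, ?_, huv.symm⟩
    rw [SimpleGraph.Walk.length_cons, G.dist_comm, h] at hp
    have h1 : G.dist u r ≤ q.length := G.dist_le q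
    have h2 : G.dist r v ≤ G.dist r u + G.dist u v := hG.dist_triangle
    rw [SimpleGraph.dist_eq_one_iff_adj.2 huv.symm] at h2
    rw [G.dist_comm] at h1
    omega

theorem exists_geodesic (hG : G.Connected) {r v : V} {d : ℕ} (h : G.dist r v = d) :
    ∃ x : ℕ → V, x d = v ∧ IsGeodesic G r x d := by
  induction d generalizing v with
  | zero => exact ⟨fun _ => v, rfl, fun i hi => by
      rw [Nat.le_zero.1 hi]; exact h, fun i hi => by omega⟩
  | succ d ih =>
    obtain ⟨u, hu, huv⟩ := exists_adj_of_dist_eq_succ hG h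
    obtain ⟨x, hxd, hx⟩ := ih hu
    refine ⟨fun i => if i ≤ d then x i else v, by simp, fun i hi => ?_, fun i hi => ?_⟩
    · by_cases hid : i ≤ d
      · simpa [hid] using hx.dist_eq i hid
      · obtain rfl : i = d + 1 := by omega
        simpa [hid] using h
    · by_cases hid : i < d
      · simpa [hid.le, Nat.succ_le_of_lt hid] using hx.adj i hid
      · obtain rfl : i = d := by omega
        simpa [hxd] using huv

theorem dist_le_succ_of_adj (hG : G.Connected) (r : V) {u v : V} (h : G.Adj u v) :
    G.dist r v ≤ G.dist r u + 1 := by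
  have := hG.dist_triangle (u := r) (v := u) (w := v)
  rwa [SimpleGraph.dist_eq_one_iff_adj.2 h] at this

/-- Vertices on levels that differ by at least two are not adjacent. -/
theorem not_adj_of_dist (hG : G.Connected) (r : V) {u v : V}
    (h : G.dist r u + 2 ≤ G.dist r v) : ¬ G.Adj u v := fun h' => by
  have := dist_le_succ_of_adj hG r h'
  omega

theorem IsGeodesic.adj_iff (hG : G.Connected) {r : V} {x : ℕ → V} {e : ℕ}
    (hx : IsGeodesic G r x e) {i j : ℕ} (hi : i ≤ e) (hj : j ≤ e) :
    G.Adj (x i) (x j) ↔ i + 1 = j ∨ j + 1 = i := by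
  constructor
  · intro h
    have h1 := dist_le_succ_of_adj hG r h
    have h2 := dist_le_succ_of_adj hG r h.symm
    rw [hx.dist_eq i hi, hx.dist_eq j hj] at h1 h2
    have : i ≠ j := fun hij => h.ne (hij ▸ rfl)
    omega
  · rintro (rfl | rfl)
    · exact hx.adj i (by omega)
    · exact (hx.adj j (by omega)).symm

theorem IsGeodesic.injOn {r : V} {x : ℕ → V} {e : ℕ} (hx : IsGeodesic G r x e) {i j : ℕ}
    (hi : i ≤ e) (hj : j ≤ e) (h : x i = x j) : i = j := by
  rw [← hx.dist_eq i hi, h, hx.dist_eq j hj]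

/-- A graph without induced `P_n` has no two vertices at distance `n` or more. -/
theorem dist_lt_of_path_free (hG : G.Connected) {n : ℕ}
    (hP : ¬ (path n).graph.IsIndContained G) (r v : V) : G.dist r v < n := by
  by_contra! h
  obtain ⟨x, -, hx⟩ := exists_geodesic hG (r := r) (v := v) rfl
  refine hP (isIndContained_of_adj_iff (fun i : Fin n => x i)
    (fun i j hij => Fin.ext (hx.injOn (by omega) (by omega) hij)) fun i j => ?_)
  exact (hx.adj_iff hG (by omega) (by omega)).trans SimpleGraph.pathGraph_adj.symm

/-- A large induced matching between consecutive levels whose upper side is at level `e` gives a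
`K_n^*` or `K_{1,n}^*`. Either `n` upper ends have a common neighbour one level up, which is too
far from the lower ends, or a matching of the same kind exists one level up. -/
theorem exists_bound_indMatching_levels (n e : ℕ) : ∃ k : ℕ, ∀ {V : Type u} {G : SimpleGraph V}
    [Finite V], G.Connected →
    ¬ (completePendant n).graph.IsIndContained G → ¬ (starPendant n).graph.IsIndContained G →
    ∀ (r : V) (a b : Fin k → V), (∀ i, G.dist r (a i) = e) → (∀ i, G.dist r (b i) = e + 1) →
      ¬ IsIndMatching G a b := by
  classical
  induction e with
  | zero =>
    refine ⟨2, fun hG _ _ r a b ha _ hab => ?_⟩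
    have h := fun i => (hG.dist_eq_zero_iff).1 (ha i)
    exact absurd (hab.left_injective ((h 0).symm.trans (h 1))) (by decide)
  | succ e ih =>
    obtain ⟨k', hk'⟩ := ih
    obtain ⟨k, hk⟩ := exists_star_or_indMatching.{u} n n k'
    refine ⟨k, fun {V G} _ hG hK hS r a b ha hb hab => ?_⟩
    have hI : ∀ v ∈ Finset.univ.image a, ∃ i, a i = v := fun v hv => by simpa using hv
    rcases hk hK {x | G.dist r x = e} (Finset.univ.image a)
      (by rw [Finset.card_image_of_injective _ hab.left_injective]; simp)
      (by
        intro u hu v hv _ h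
        obtain ⟨i, rfl⟩ := hI u hu
        obtain ⟨j, rfl⟩ := hI v hv
        exact hab.left i j h)
      (by
        intro v hv
        obtain ⟨i, rfl⟩ := hI v hv
        exact exists_adj_of_dist_eq_succ hG (ha i)) with
      ⟨x, hx, hxc⟩ | ⟨a', b', ha', hb', hab'⟩
    · obtain ⟨y, hy, hyI⟩ := exists_injective_of_le_card hxc
      simp only [Finset.mem_filter] at hyI
      choose f hf using fun i => hI _ (hyI i).1
      have hfi : Function.Injective f := fun i j h => hy (by rw [← hf, ← hf, h])
      have hx : G.dist r x = e := hx
      refine hS (starPendant_isIndContained (w := x) (a := fun i => a (f i))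
        (b := fun i => b (f i)) (fun i => hf i ▸ (hyI i).2)
        (fun i => not_adj_of_dist hG r (by rw [hx, hb])) ?_ (fun i j => hab.left _ _)
        (fun i j => hab.right _ _) (fun i j => (hab.adj_iff _ _).trans hfi.eq_iff))
      intro i h
      have := hb (f i)
      rw [← h, hx] at this
      omega
    · refine hk' hG hK hS r a' b' ha' (fun i => ?_) hab'
      obtain ⟨j, hj⟩ := hI _ (hb' i)
      rw [← hj, ha]

/-- In a connected graph of bounded radius around `r`, a large independent set yields a vertex `x`
with many neighbours in that set, all of them one level further from `r` than `x`. -/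
theorem exists_star_levels (n m D : ℕ) : ∃ M : ℕ, ∀ {V : Type u} {G : SimpleGraph V}
    [Finite V], G.Connected →
    ¬ (completePendant n).graph.IsIndContained G → ¬ (starPendant n).graph.IsIndContained G →
    ∀ r : V, (∀ v, G.dist r v < D) →
    ∀ J : Finset V, G.IsIndepSet (J : Set V) → M ≤ J.card →
    ∃ (e : ℕ) (x : V) (Z : Finset V), G.dist r x = e ∧ Z ⊆ J ∧ m ≤ Z.card ∧
      ∀ z ∈ Z, G.dist r z = e + 1 ∧ G.Adj x z := by
  classical
  choose k hk using exists_bound_indMatching_levels.{u} n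
  choose N hN using fun e => exists_star_or_indMatching.{u} n m (k e)
  refine ⟨∑ e ∈ Finset.range D, N e + 2, fun {V G} _ hG hK hS r hD J hJ hJc => ?_⟩
  -- Some level other than level `0` contains many vertices of `J`.
  have hlev : ∃ e, N e ≤ (J.filter fun v => G.dist r v = e + 1).card := by
    by_contra! hcon
    have hsub : J ⊆ insert r
        ((Finset.range D).biUnion fun e => J.filter fun v => G.dist r v = e + 1) := by
      intro v hv
      rcases h : G.dist r v with _ | e
      · exact Finset.mem_insert.2 (Or.inl ((hG.dist_eq_zero_iff.1 h).symm))
      · refine Finset.mem_insert_of_mem (Finset.mem_biUnion.2 ⟨e, ?_, by simp [hv, h]⟩)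
        have := hD v
        simp only [Finset.mem_range]
        omega
    have h1 := (Finset.card_le_card hsub).trans (Finset.card_insert_le _ _)
    have h2 : ((Finset.range D).biUnion fun e => J.filter fun v => G.dist r v = e + 1).card ≤
        ∑ e ∈ Finset.range D, N e :=
      Finset.card_biUnion_le.trans (Finset.sum_le_sum fun e _ => (hcon e).le)
    omega
  obtain ⟨e, he⟩ := hlev
  rcases hN e hK {x | G.dist r x = e} _ he
    (hJ.mono (Finset.coe_subset.2 (Finset.filter_subset _ _)))
    (fun v hv => exists_adj_of_dist_eq_succ hG (Finset.mem_filter.1 hv).2) with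
    ⟨x, hx, hxc⟩ | ⟨a, b, ha, hb, hab⟩
  · exact ⟨e, x, _, hx, (Finset.filter_subset _ _).trans (Finset.filter_subset _ _), hxc,
      fun z hz => by simp only [Finset.mem_filter] at hz; exact ⟨hz.1.2, hz.2⟩⟩
  · exact (hk e hG hK hS r a b ha (fun i => (Finset.mem_filter.1 (hb i)).2) hab).elim

/-- Leaves attached to the two ends `x s` and `x e` of a segment of a geodesic form a bistar. -/
theorem IsGeodesic.bistar_isIndContained (hG : G.Connected) {r : V} {x : ℕ → V} {e s n : ℕ}
    (hx : IsGeodesic G r x e) (hs : s < e) {y z : Fin n → V}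
    (hyi : Function.Injective y) (hzi : Function.Injective z)
    (hy : ∀ i j, ¬ G.Adj (y i) (y j)) (hz : ∀ i j, ¬ G.Adj (z i) (z j))
    (hyz : ∀ i j, ¬ G.Adj (y i) (z j))
    (hxy : ∀ j, G.Adj (x s) (y j)) (hxy' : ∀ i j, s < i → i ≤ e → ¬ G.Adj (x i) (y j))
    (hxz : ∀ j, G.Adj (x e) (z j)) (hxz' : ∀ i j, s ≤ i → i < e → ¬ G.Adj (x i) (z j)) :
    (bistar n (e - s + 1)).graph.IsIndContained G := by
  refine DomRamsey.bistar_isIndContained (by omega) (f := fun i => x (s + i)) ?_ ?_ hyi hzi hy hz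
    hyz ?_ ?_
  · intro i j h
    have := hx.injOn (by omega) (by omega) h
    exact Fin.ext (by omega)
  · intro i j
    rw [hx.adj_iff hG (by omega) (by omega), SimpleGraph.pathGraph_adj]
    omega
  · intro i j
    refine ⟨fun h => by_contra fun h0 => hxy' _ j (by omega) (by omega) h, fun h => ?_⟩
    simpa [h] using hxy j
  · intro i j
    refine ⟨fun h => by_contra fun h0 => hxz' _ j (by omega) (by omega) h, fun h => ?_⟩
    have : s + i.val = e := by omega
    simpa [this] using hxz j

end Levels

/-! ### Irredundant sets and independent sets -/

section Irredundant

variable {V : Type u} {G : SimpleGraph V}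

theorem mem_privateNbhd {v x : V} {S : Set V} : x ∈ privateNbhd G v S ↔
    (x = v ∨ G.Adj v x) ∧ ∀ u ∈ S, u ≠ v → x ≠ u ∧ ¬ G.Adj u x := by
  simp [privateNbhd, closedNbhd, closedNbhdSet]

/-- A large irredundant set through `w` gives a large independent set outside `N[w]`: by Ramsey's
theorem the private neighbours of its other members contain a large independent set or a large
clique, and in the second case a `K_n^*` or a `CK_n` appears. -/
theorem exists_indepSet_of_le_irsAt (n M : ℕ) : ∃ c : ℕ, ∀ {V : Type u} {G : SimpleGraph V}
    [Finite V], ¬ (completePendant n).graph.IsIndContained G →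
    ¬ (coupledComplete n).graph.IsIndContained G → ∀ w, c ≤ irsAt G w →
    ∃ J : Finset V, G.IsIndepSet (J : Set V) ∧ M ≤ J.card ∧ ∀ v ∈ J, v ≠ w ∧ ¬ G.Adj w v := by
  classical
  obtain ⟨q, hq⟩ := exists_ramsey_graph.{u} n
  -- The summand `2` makes sure that a clique of private neighbours has more than one vertex.
  obtain ⟨c, hc⟩ := exists_ramsey_graph.{u} (M + (q + 2))
  refine ⟨c + 1, fun {V G} _ hK hC w hw => ?_⟩
  obtain ⟨S, hwS, hS, hSc⟩ := (irsAt_isGreatest G w).1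
  have := Fintype.ofFinite V
  have hcard : c ≤ (S \ {w}).toFinset.card := by
    have h := Set.ncard_sdiff_singleton_add_one hwS
    rw [← Set.ncard_eq_toFinset_card']
    omega
  obtain ⟨s, hs, hsS⟩ := exists_injective_of_le_card hcard
  simp only [Set.mem_toFinset, Set.mem_sdiff, Set.mem_singleton_iff] at hsS
  choose p hp using fun i => hS (s i) (hsS i).1
  simp only [mem_privateNbhd] at hp
  have hps : ∀ i j, i ≠ j → p i ≠ s j ∧ ¬ G.Adj (s j) (p i) := fun i j hij =>
    (hp i).2 _ (hsS j).1 fun h => hij (hs h).symm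
  have hpi : Function.Injective p := fun i j h => by
    by_contra hij
    rcases (hp i).1 with h' | h'
    · exact (hps j i (Ne.symm hij)).1 (h ▸ h')
    · exact (hps j i (Ne.symm hij)).2 (h ▸ h')
  obtain ⟨g, hg | hg⟩ := hc G p
  · -- A private neighbour with another private neighbour adjacent to it differs from its owner.
    have hne : ∀ i, p (g i) ≠ s (g i) := fun i h => by
      have : Nontrivial (Fin (M + (q + 2))) := Fin.nontrivial_iff_two_le.2 (by omega)
      obtain ⟨j, hj⟩ := exists_ne i
      exact (hps (g j) (g i) (by simpa using hj)).2 (h ▸ hg i j hj.symm)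
    let ι : Fin q ↪o Fin c := (Fin.castLEOrderEmb (by omega : q ≤ M + (q + 2))).trans g
    have hadj : ∀ i j, G.Adj (s (ι i)) (p (ι j)) ↔ i = j := fun i j => by
      constructor
      · intro h
        by_contra hij
        exact (hps (ι j) (ι i) (by simpa using Ne.symm hij)).2 h
      · rintro rfl
        exact (hp (ι i)).1.resolve_left (hne _)
    have hclique : ∀ i j, i ≠ j → G.Adj (p (ι i)) (p (ι j)) := fun i j hij =>
      hg _ _ (by simpa using hij)
    obtain ⟨g', hg' | hg'⟩ := hq G (s ∘ ι)
    · refine (hC (coupledComplete_isIndContained (a := fun i => s (ι (g' i)))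
        (b := fun i => p (ι (g' i))) hg' (fun i j hij => hclique _ _ (by simpa using hij))
        (fun i j => (hadj _ _).trans (by simp)) fun i j h => ?_)).elim
      by_cases hij : i = j
      · exact hne _ (hij ▸ h.symm)
      · exact (hps (ι (g' j)) (ι (g' i)) (by simpa using Ne.symm hij)).1 h.symm
    · exact (hK (completePendant_isIndContained (a := fun i => p (ι (g' i)))
        (b := fun i => s (ι (g' i))) (fun i j hij => hclique _ _ (by simpa using hij)) hg'
        (fun i j => (G.adj_comm _ _).trans ((hadj _ _).trans (by simp [eq_comm]))))).elim
  · refine ⟨Finset.univ.image (p ∘ g), ?_, ?_, ?_⟩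
    · intro u hu v hv _ h
      simp only [Finset.coe_image, Set.mem_image, Function.comp] at hu hv
      obtain ⟨i, -, rfl⟩ := hu
      obtain ⟨j, -, rfl⟩ := hv
      exact hg i j h
    · rw [Finset.card_image_of_injective _ (hpi.comp g.injective)]
      simp
    · intro v hv
      simp only [Finset.mem_image, Function.comp] at hv
      obtain ⟨i, -, rfl⟩ := hv
      exact (hp (g i)).2 w hwS (Ne.symm (hsS (g i)).2)

end Irredundant

/-! ### Boundedness -/

/-- In a connected graph without the special graphs some vertex lies in no large irredundant set.
The vertex is the centre `w` of a largest induced star. Otherwise a second large induced star lies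
further away from `w`, and comparing both stars along a geodesic between their centres produces a
bistar, a `K_{n,n}`, a `K_{1,n}^*`, or an induced star that is larger than the largest one. -/
theorem exists_irsAt_lt (n : ℕ) (hn : 5 ≤ n) : ∃ c : ℕ, ∀ {V : Type u} {G : SimpleGraph V}
    [Finite V], G.Connected → (∀ H ∈ irsFamily n, ¬ H.graph.IsIndContained G) →
    ∃ w, irsAt G w < c := by
  classical
  obtain ⟨k, hk⟩ := exists_parallel_subsequence.{u} n
  -- The summand `3 * k` pays for the vertices lost to a matching and to non-neighbours of `x`
  -- when `w` and `x` are adjacent, the summand `4 * n` for those lost to bistars otherwise.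
  obtain ⟨M, hM⟩ := exists_star_levels.{u} n (3 * k + 4 * n + 1) n
  obtain ⟨c, hc⟩ := exists_indepSet_of_le_irsAt.{u} n M
  refine ⟨c, fun {V G} _ hG hF => ?_⟩
  have := Fintype.ofFinite V
  by_contra! hirs
  have hS := hF (starPendant n) (by simp [irsFamily])
  have hK := hF (completePendant n) (by simp [irsFamily])
  have hP := hF (path n) (by simp [irsFamily])
  have hKB := hF (completeBip n) (by simp [irsFamily])
  have hCK := hF (coupledComplete n) (by simp [irsFamily])
  have hBS : ∀ p, 2 ≤ p → ¬ (bistar n p).graph.IsIndContained G := fun p hp h => by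
    by_cases hpn : p + 3 ≤ n
    · exact hF (bistar n p) (Or.inr ⟨p, hp, hpn, rfl⟩) h
    · exact hP ((path_isIndContained_bistar (by omega) (by omega) (by omega)).trans h)
  have hstar : ∀ w, ∃ (e : ℕ) (x : V) (Z : Finset V), 1 ≤ e ∧ G.dist w x = e ∧
      G.IsIndepSet (Z : Set V) ∧ 3 * k + 4 * n + 1 ≤ Z.card ∧
      ∀ z ∈ Z, G.dist w z = e + 1 ∧ G.Adj x z := fun w => by
    obtain ⟨J, hJ, hJc, hJw⟩ := hc hK hCK w (hirs w)
    obtain ⟨e, x, Z, hx, hZJ, hZc, hZ⟩ :=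
      hM hG hK hS w (dist_lt_of_path_free hG hP w) J hJ hJc
    refine ⟨e, x, Z, Nat.one_le_iff_ne_zero.2 fun he => ?_, hx,
      hJ.mono (Finset.coe_subset.2 hZJ), hZc, hZ⟩
    obtain ⟨z, hz⟩ := Finset.card_pos.1 (by omega : 0 < Z.card)
    rw [he, hG.dist_eq_zero_iff] at hx
    exact (hJw z (hZJ hz)).2 (hx ▸ (hZ z hz).2)
  -- Choose a largest induced star, with centre `w` and leaves `Y`.
  obtain ⟨w₀⟩ := hG.nonempty
  obtain ⟨⟨w, Y⟩, hwY, hmax⟩ := Finset.exists_max_image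
    (Finset.univ.filter fun q : V × Finset V =>
      G.IsIndepSet (q.2 : Set V) ∧ ∀ y ∈ q.2, G.Adj q.1 y)
    (fun q => q.2.card) ⟨(w₀, ∅), by simp⟩
  simp only [Finset.mem_filter, Finset.mem_univ, true_and, Prod.forall] at hwY hmax
  obtain ⟨hY, hwY⟩ := hwY
  have hYc : 3 * k + 4 * n + 1 ≤ Y.card := by
    obtain ⟨e, x, Z, -, -, hZi, hZc, hZ⟩ := hstar w
    exact hZc.trans (hmax x Z ⟨hZi, fun z hz => (hZ z hz).2⟩)
  obtain ⟨e, x, Z, he, hx, hZi, hZc, hZ⟩ := hstar w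
  obtain ⟨xs, hxe, hxs⟩ := exists_geodesic hG hx
  have hx0 : xs 0 = w := (hG.dist_eq_zero_iff.1 (hxs.dist_eq 0 (Nat.zero_le _))).symm
  have hYd : ∀ y ∈ Y, G.dist w y = 1 := fun y hy => SimpleGraph.dist_eq_one_iff_adj.2 (hwY y hy)
  have hYa : ∀ u ∈ Y, ∀ v ∈ Y, ¬ G.Adj u v := fun u hu v hv h => hY hu hv h.ne h
  have hZa : ∀ u ∈ Z, ∀ v ∈ Z, ¬ G.Adj u v := fun u hu v hv h => hZi hu hv h.ne h
  -- By maximality of `Y` no larger independent set lies in the neighbourhood of `x`.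
  have hunion : ∀ Y' ⊆ Y, ∀ Z' ⊆ Z, (∀ y ∈ Y', G.Adj x y) →
      (∀ y ∈ Y', ∀ z ∈ Z', ¬ G.Adj y z) → Y'.card + Z'.card ≤ Y.card := by
    intro Y' hY' Z' hZ' hxY' hno
    rw [← Finset.card_union_of_disjoint]
    · refine hmax x (Y' ∪ Z') ⟨?_, ?_⟩
      · intro u hu v hv _
        rw [Finset.mem_coe, Finset.mem_union] at hu hv
        rcases hu with hu | hu <;> rcases hv with hv | hv
        · exact hYa u (hY' hu) v (hY' hv)
        · exact hno u hu v hv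
        · exact fun h => hno v hv u hu h.symm
        · exact hZa u (hZ' hu) v (hZ' hv)
      · intro y hy
        rcases Finset.mem_union.1 hy with hy | hy
        · exact hxY' y hy
        · exact (hZ y (hZ' hy)).2
    · refine Finset.disjoint_left.2 fun v hv hv' => ?_
      have h1 := hYd v (hY' hv)
      have h2 := (hZ v (hZ' hv')).1
      omega
  rcases he.eq_or_lt with rfl | he
  · -- The centres are adjacent.
    have hsplit := Finset.card_filter_add_card_filter_not (s := Y) (fun y => G.Adj x y)
    obtain ⟨z₀, hz₀, hz₀Z⟩ := exists_injective_of_le_card (by omega : k ≤ Z.card)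
    have hY0 : (Y.filter fun y => ¬ G.Adj x y).card < k := by
      by_contra! hle
      obtain ⟨y, hyi, hyY⟩ := exists_injective_of_le_card hle
      simp only [Finset.mem_filter] at hyY
      obtain ⟨g, hg⟩ := hk hyi hz₀ (fun i j => hYa _ (hyY i).1 _ (hyY j).1)
        (fun i j => hZa _ (hz₀Z i) _ (hz₀Z j)) hKB
      refine hBS _ (le_refl 2) (hxs.bistar_isIndContained hG (s := 0) Nat.zero_lt_one
        (y := fun i => y (g (Fin.castAdd n i))) (z := fun i => z₀ (g (Fin.natAdd n i)))
        (fun i j h => by simpa using hyi h) (fun i j h => by simpa using hz₀ h)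
        (fun i j => hYa _ (hyY _).1 _ (hyY _).1) (fun i j => hZa _ (hz₀Z _) _ (hz₀Z _))
        (fun i j => hg _ _ ?_) (fun j => hx0 ▸ hwY _ (hyY _).1) (fun i j h0 h1 => ?_)
        (fun j => hxe ▸ (hZ _ (hz₀Z _)).2) (fun i j h0 h1 => ?_))
      · simp only [ne_eq, Fin.ext_iff, Fin.val_castAdd, Fin.val_natAdd]; omega
      · obtain rfl : i = 1 := by omega
        exact hxe ▸ (hyY _).2
      · obtain rfl : i = 0 := by omega
        refine not_adj_of_dist hG w ?_
        rw [(hZ _ (hz₀Z _)).1, hx0, SimpleGraph.dist_self]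
    rcases exists_matching_or_unrelated G.Adj (Y.filter fun y => G.Adj x y) Z k with
      ⟨y, z, hy, hz, hyY, hzZ, hyz⟩ | ⟨Y', hY', Z', hZ', hYc', hZc', hno⟩
    · simp only [Finset.mem_filter] at hyY
      obtain ⟨g, hg⟩ := hk hy hz (fun i j => hYa _ (hyY i).1 _ (hyY j).1)
        (fun i j => hZa _ (hzZ i) _ (hzZ j)) hKB
      refine hS (starPendant_isIndContained (w := w) (a := fun i => y (g (Fin.castAdd n i)))
        (b := fun i => z (g (Fin.castAdd n i))) (fun i => hwY _ (hyY _).1)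
        (fun i => not_adj_of_dist hG w (by rw [(hZ _ (hzZ _)).1, SimpleGraph.dist_self]))
        (fun i h => ?_) (fun i j => hYa _ (hyY _).1 _ (hyY _).1)
        (fun i j => hZa _ (hzZ _) _ (hzZ _)) (fun i j => ⟨fun h => ?_, fun h => ?_⟩))
      · have := (hZ _ (hzZ (g (Fin.castAdd n i)))).1
        rw [← h, SimpleGraph.dist_self] at this
        omega
      · by_contra hij
        exact hg _ _ (by simpa using hij) h
      · exact h ▸ hyz _
    · have := hunion Y' (hY'.trans (Finset.filter_subset _ _)) Z' hZ'
        (fun y hy => (Finset.mem_filter.1 (hY' hy)).2) hno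
      omega
  · -- The centres are at distance at least two, so the leaf sets are not adjacent. The leaves `y`
    -- of `w` are classified by the last vertex of the geodesic that is adjacent to `y`.
    have hyz : ∀ y ∈ Y, ∀ z ∈ Z, ¬ G.Adj y z := fun y hy z hz =>
      not_adj_of_dist hG w (by rw [hYd y hy, (hZ z hz).1]; omega)
    have hlast : ∀ s ≤ 2, s < e → ∀ W ⊆ Y, (∀ y ∈ W, G.Adj (xs s) y) →
        (∀ y ∈ W, ∀ i, s < i → i ≤ 2 → ¬ G.Adj (xs i) y) → W.card < n := by
      intro s hs hse W hW hsW hiW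
      by_contra! hle
      obtain ⟨y, hyi, hyW⟩ := exists_injective_of_le_card hle
      obtain ⟨z, hzi, hzZ⟩ := exists_injective_of_le_card (by omega : n ≤ Z.card)
      refine hBS _ (by omega) (hxs.bistar_isIndContained hG hse hyi hzi
        (fun i j => hYa _ (hW (hyW i)) _ (hW (hyW j))) (fun i j => hZa _ (hzZ i) _ (hzZ j))
        (fun i j => hyz _ (hW (hyW i)) _ (hzZ j)) (fun j => hsW _ (hyW j))
        (fun i j hi hie => ?_) (fun j => hxe ▸ (hZ _ (hzZ j)).2) (fun i j hi hie => ?_))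
      · rcases le_or_gt i 2 with h2 | h2
        · exact hiW _ (hyW j) i hi h2
        · intro h
          refine not_adj_of_dist hG w ?_ h.symm
          rw [hYd _ (hW (hyW j)), hxs.dist_eq i hie]
          omega
      · refine not_adj_of_dist hG w ?_
        rw [hxs.dist_eq i hie.le, (hZ _ (hzZ j)).1]
        omega
    have hs2 := Finset.card_filter_add_card_filter_not (s := Y) (fun y => G.Adj (xs 2) y)
    have hs1 := Finset.card_filter_add_card_filter_not
      (s := Y.filter fun y => ¬ G.Adj (xs 2) y) (fun y => G.Adj (xs 1) y)
    have hc0 := hlast 0 (by omega) (by omega)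
      ((Y.filter fun y => ¬ G.Adj (xs 2) y).filter fun y => ¬ G.Adj (xs 1) y)
      ((Finset.filter_subset _ _).trans (Finset.filter_subset _ _))
      (fun y hy => by
        simp only [Finset.mem_filter] at hy
        exact hx0 ▸ hwY y hy.1.1)
      (fun y hy i hi hi2 => by
        simp only [Finset.mem_filter] at hy
        obtain rfl | rfl : i = 1 ∨ i = 2 := by omega
        exacts [hy.2, hy.1.2])
    have hc1 := hlast 1 (by omega) he
      ((Y.filter fun y => ¬ G.Adj (xs 2) y).filter fun y => G.Adj (xs 1) y)
      ((Finset.filter_subset _ _).trans (Finset.filter_subset _ _))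
      (fun y hy => (Finset.mem_filter.1 hy).2)
      (fun y hy i hi hi2 => by
        simp only [Finset.mem_filter] at hy
        obtain rfl : i = 2 := by omega
        exact hy.1.2)
    rcases Nat.succ_le_of_lt he |>.eq_or_lt with rfl | he
    · have := hunion _ (Finset.filter_subset (fun y => G.Adj (xs 2) y) Y) Z Finset.Subset.rfl
        (fun y hy => hxe ▸ (Finset.mem_filter.1 hy).2)
        (fun y hy => hyz y (Finset.mem_filter.1 hy).1)
      omega
    · have := hlast 2 le_rfl he _ (Finset.filter_subset (fun y => G.Adj (xs 2) y) Y)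
        (fun y hy => (Finset.mem_filter.1 hy).2) (fun y hy i hi hi2 => by omega)
      omega

/-! ### The special graphs have large irredundance saturation number -/

section Lower

variable {V : Type u} {G : SimpleGraph V}

theorem isIrredundant_of_not_adj {S : Set V} (h : ∀ u ∈ S, ∀ v ∈ S, ¬ G.Adj u v) :
    IsIrredundant G S := fun s hs =>
  ⟨s, mem_privateNbhd.2 ⟨Or.inl rfl, fun u hu hus => ⟨hus.symm, h u hu s hs⟩⟩⟩

/-- Every vertex of `G` lies in an irredundant set with at least `c` elements. -/
def IrredundantThrough (G : SimpleGraph V) (c : ℕ) : Prop :=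
  ∀ v, ∃ S : Set V, v ∈ S ∧ IsIrredundant G S ∧ c ≤ S.ncard

theorem le_ncard_of_injective [Finite V] {m : ℕ} {f : Fin m → V} (hf : Function.Injective f)
    {S : Set V} (h : Set.range f ⊆ S) : m ≤ S.ncard := by
  have h1 := Set.ncard_le_ncard h (Set.toFinite S)
  rwa [Set.ncard_range_of_injective hf, Nat.card_fin] at h1

theorem exists_irredundant_of_not_adj [Finite V] {m c : ℕ} (hc : c ≤ m) {v : V} {f : Fin m → V}
    (hf : Function.Injective f) (h : ∀ i j, ¬ G.Adj (f i) (f j)) (hv : ∀ i, ¬ G.Adj v (f i)) :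
    ∃ S : Set V, v ∈ S ∧ IsIrredundant G S ∧ c ≤ S.ncard := by
  refine ⟨insert v (Set.range f), Set.mem_insert _ _, isIrredundant_of_not_adj ?_,
    hc.trans (le_ncard_of_injective hf (Set.subset_insert _ _))⟩
  rintro _ (rfl | ⟨i, rfl⟩) _ (rfl | ⟨j, rfl⟩)
  · exact G.irrefl
  · exact hv j
  · exact fun h => hv i h.symm
  · exact h i j

theorem exists_irredundant_of_private [Finite V] {m c : ℕ} (hc : c ≤ m) {f p : Fin m → V}
    (hf : Function.Injective f) (hne : ∀ i j, p i ≠ f j) (h : ∀ i j, G.Adj (f j) (p i) ↔ j = i)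
    (k : Fin m) : ∃ S : Set V, f k ∈ S ∧ IsIrredundant G S ∧ c ≤ S.ncard := by
  refine ⟨Set.range f, ⟨k, rfl⟩, ?_, hc.trans (le_ncard_of_injective hf subset_rfl)⟩
  rintro _ ⟨i, rfl⟩
  refine ⟨p i, mem_privateNbhd.2 ⟨Or.inr ((h i i).2 rfl), ?_⟩⟩
  rintro _ ⟨j, rfl⟩ hji
  exact ⟨hne i j, fun h' => hji (congrArg f ((h i j).1 h'))⟩

theorem IrredundantThrough.of_iso {W : Type v} {H : SimpleGraph W} {c : ℕ}
    (h : IrredundantThrough G c) (e : H ≃g G) : IrredundantThrough H c := by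
  intro w
  obtain ⟨S, hv, hS, hc⟩ := h (e w)
  refine ⟨e ⁻¹' S, hv, fun s hs => ?_, ?_⟩
  · obtain ⟨x, hx⟩ := hS (e s) hs
    obtain ⟨x, rfl⟩ := e.surjective x
    rw [mem_privateNbhd] at hx
    refine ⟨x, mem_privateNbhd.2 ⟨hx.1.imp (fun h => e.injective h) e.map_adj_iff.1, ?_⟩⟩
    intro u hu hus
    obtain ⟨h1, h2⟩ := hx.2 (e u) hu (e.injective.ne hus)
    exact ⟨fun h => h1 (h ▸ rfl), fun h => h2 (e.map_adj_iff.2 h)⟩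
  · rwa [Set.ncard_preimage_of_injective_subset_range e.injective
      (by rw [Set.range_eq_univ.2 e.surjective]; exact Set.subset_univ _)]

theorem IrredundantThrough.le_irs {G : FinGraph.{u}} [Nonempty G.V] {c : ℕ}
    (h : IrredundantThrough G.graph c) : c ≤ irs G := by
  obtain ⟨v, hv⟩ := (irs_isLeast G).1
  obtain ⟨S, hvS, hS, hc⟩ := h v
  rw [← hv]
  exact hc.trans ((irsAt_isGreatest G.graph v).2 ⟨S, hvS, hS, rfl⟩)

end Lower

theorem starPendant_large (n : ℕ) : (starPendant n).graph.Connected ∧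
    IrredundantThrough (starPendant n).graph n := by
  change (addPendants (completeBipartiteGraph (Fin 1) (Fin n)) (Set.range Sum.inr)).Connected ∧
    IrredundantThrough (addPendants (completeBipartiteGraph (Fin 1) (Fin n)) (Set.range Sum.inr)) n
  constructor
  · rw [SimpleGraph.connected_iff_exists_forall_reachable]
    have h1 : ∀ i : Fin n,
        (addPendants (completeBipartiteGraph (Fin 1) (Fin n)) (Set.range Sum.inr)).Reachable
          (Sum.inl (Sum.inl 0)) (Sum.inl (Sum.inr i)) := fun i =>
      SimpleGraph.Adj.reachable (by simp [addPendants])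
    refine ⟨Sum.inl (Sum.inl 0), ?_⟩
    rintro ((i | i) | ⟨_, i, rfl⟩)
    · rw [Subsingleton.elim i 0]
    · exact h1 i
    · exact (h1 i).trans (SimpleGraph.Adj.reachable (by simp [addPendants]))
  · rintro ((i | i) | ⟨_, i, rfl⟩)
    · exact exists_irredundant_of_not_adj le_rfl (f := fun j : Fin n => Sum.inr ⟨_, j, rfl⟩)
        (fun i j h => Sum.inr_injective (congrArg Subtype.val (Sum.inr_injective h)))
        (by simp [addPendants]) (by simp [addPendants])
    · exact exists_irredundant_of_not_adj le_rfl (f := fun j : Fin n => Sum.inl (Sum.inr j))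
        (fun i j h => by simpa using h)
        (by simp [addPendants]) (by simp [addPendants])
    · exact exists_irredundant_of_not_adj le_rfl (f := fun j : Fin n => Sum.inr ⟨_, j, rfl⟩)
        (fun i j h => Sum.inr_injective (congrArg Subtype.val (Sum.inr_injective h)))
        (by simp [addPendants]) (by simp [addPendants])

theorem completePendant_large (n : ℕ) (hn : 0 < n) : (completePendant n).graph.Connected ∧
    IrredundantThrough (completePendant n).graph n := by
  change (addPendants (⊤ : SimpleGraph (Fin n)) Set.univ).Connected ∧
    IrredundantThrough (addPendants (⊤ : SimpleGraph (Fin n)) Set.univ) n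
  constructor
  · rw [SimpleGraph.connected_iff_exists_forall_reachable]
    have h1 : ∀ i : Fin n, (addPendants (⊤ : SimpleGraph (Fin n)) Set.univ).Reachable
          (Sum.inl ⟨0, hn⟩) (Sum.inl i) := fun i => by
      by_cases hi : ⟨0, hn⟩ = i
      · rw [hi]
      · exact SimpleGraph.Adj.reachable (by simpa [addPendants] using hi)
    refine ⟨Sum.inl ⟨0, hn⟩, ?_⟩
    rintro (i | ⟨i, _⟩)
    · exact h1 i
    · exact (h1 i).trans (SimpleGraph.Adj.reachable (by simp [addPendants]))
  · rintro (i | ⟨i, _⟩)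
    · exact exists_irredundant_of_private le_rfl (f := Sum.inl)
        (p := fun i => Sum.inr ⟨i, trivial⟩) Sum.inl_injective (by simp) (by simp [addPendants]) i
    · exact exists_irredundant_of_not_adj le_rfl (f := fun j : Fin n => Sum.inr ⟨j, trivial⟩)
        (fun i j h => congrArg Subtype.val (Sum.inr_injective h))
        (by simp [addPendants]) (by simp [addPendants])

theorem path_large (n c : ℕ) (hn : 2 * c < n) : (path n).graph.Connected ∧
    IrredundantThrough (path n).graph c := by
  obtain ⟨n, rfl⟩ := Nat.exists_eq_succ_of_ne_zero (by omega : n ≠ 0)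
  change (SimpleGraph.pathGraph (n + 1)).Connected ∧
    IrredundantThrough (SimpleGraph.pathGraph (n + 1)) c
  refine ⟨SimpleGraph.pathGraph_connected n, fun v => ?_⟩
  -- The vertices whose index has the parity of `v` are pairwise non-adjacent.
  refine exists_irredundant_of_not_adj le_rfl
    (f := fun i : Fin c => ⟨2 * i.val + v.val % 2, by omega⟩) ?_ ?_ ?_
  · intro i j h
    simp only [Fin.mk.injEq] at h
    exact Fin.ext (by omega)
  · intro i j
    rw [SimpleGraph.pathGraph_adj]
    dsimp only
    omega
  · intro i
    rw [SimpleGraph.pathGraph_adj]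
    dsimp only
    omega

theorem completeBip_large (n : ℕ) (hn : 0 < n) : (completeBip n).graph.Connected ∧
    IrredundantThrough (completeBip n).graph n := by
  change (completeBipartiteGraph (Fin n) (Fin n)).Connected ∧
    IrredundantThrough (completeBipartiteGraph (Fin n) (Fin n)) n
  constructor
  · rw [SimpleGraph.connected_iff_exists_forall_reachable]
    have h1 : ∀ i j : Fin n, (completeBipartiteGraph (Fin n) (Fin n)).Reachable
        (Sum.inl i) (Sum.inr j) := fun i j => SimpleGraph.Adj.reachable (by simp)
    refine ⟨Sum.inl ⟨0, hn⟩, ?_⟩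
    rintro (i | i)
    · exact (h1 _ i).trans (h1 i i).symm
    · exact h1 _ i
  · rintro (i | i)
    · exact exists_irredundant_of_not_adj le_rfl (f := Sum.inl) Sum.inl_injective (by simp)
        (by simp)
    · exact exists_irredundant_of_not_adj le_rfl (f := Sum.inr) Sum.inr_injective (by simp)
        (by simp)

theorem coupledComplete_large (n : ℕ) (hn : 0 < n) : (coupledComplete n).graph.Connected ∧
    IrredundantThrough (coupledComplete n).graph n := by
  change (coupledGraph n).Connected ∧ IrredundantThrough (coupledGraph n) n
  constructor
  · rw [SimpleGraph.connected_iff_exists_forall_reachable]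
    have h1 : ∀ i : Fin n, (coupledGraph n).Reachable (Sum.inl ⟨0, hn⟩) (Sum.inl i) := fun i => by
      by_cases hi : ⟨0, hn⟩ = i
      · rw [hi]
      · exact SimpleGraph.Adj.reachable (by simpa [coupledGraph] using hi)
    refine ⟨Sum.inl ⟨0, hn⟩, ?_⟩
    rintro (i | i)
    · exact h1 i
    · exact (h1 i).trans (SimpleGraph.Adj.reachable (by simp [coupledGraph]))
  · rintro (i | i)
    · exact exists_irredundant_of_private le_rfl (f := Sum.inl) (p := Sum.inr) Sum.inl_injective
        (by simp) (by simp [coupledGraph]) i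
    · exact exists_irredundant_of_private le_rfl (f := Sum.inr) (p := Sum.inl) Sum.inr_injective
        (by simp) (by simp [coupledGraph]) i

theorem bistar_large (n p : ℕ) (hp : 2 ≤ p) : (bistar n p).graph.Connected ∧
    IrredundantThrough (bistar n p).graph n := by
  change (bistarGraph n p).Connected ∧ IrredundantThrough (bistarGraph n p) n
  constructor
  · rw [SimpleGraph.connected_iff_exists_forall_reachable]
    have h1 : ∀ i : Fin p, (bistarGraph n p).Reachable (Sum.inl ⟨0, by omega⟩) (Sum.inl i) := by
      rintro ⟨i, hi⟩
      induction i with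
      | zero => rfl
      | succ i ih => exact (ih (by omega)).trans (SimpleGraph.Adj.reachable
          (by simp [bistarGraph, SimpleGraph.pathGraph_adj]))
    refine ⟨Sum.inl ⟨0, by omega⟩, ?_⟩
    rintro (i | i | i)
    · exact h1 i
    · exact SimpleGraph.Adj.reachable (by simp [bistarGraph])
    · exact (h1 ⟨p - 1, by omega⟩).trans (SimpleGraph.Adj.reachable (by
        simp only [bistarGraph]; omega))
  · have hl := fun (v : Fin p ⊕ (Fin n ⊕ Fin n)) =>
      exists_irredundant_of_not_adj (G := bistarGraph n p) (v := v) le_rfl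
        (f := fun j : Fin n => Sum.inr (Sum.inl j)) (fun i j h => by simpa using h)
        (by simp [bistarGraph])
    rintro (i | i | i)
    · by_cases hi : i.val = 0
      · exact exists_irredundant_of_not_adj le_rfl
          (f := fun j : Fin n => Sum.inr (Sum.inr j)) (fun i j h => by simpa using h)
          (by simp [bistarGraph]) (by simp only [bistarGraph]; omega)
      · exact hl _ (by simpa [bistarGraph] using fun _ => hi)
    · exact hl _ (by simp [bistarGraph])
    · exact hl _ (by simp [bistarGraph])

theorem irsFamily_large (c : ℕ) : ∀ H ∈ irsFamily (2 * c + 5),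
    H.graph.Connected ∧ IrredundantThrough H.graph c := by
  have key : ∀ H : FinGraph.{0},
      (H.graph.Connected ∧ IrredundantThrough H.graph (2 * c + 5)) →
      H.graph.Connected ∧ IrredundantThrough H.graph c := fun H h => ⟨h.1, fun v => by
    obtain ⟨S, hv, hS, hc⟩ := h.2 v
    exact ⟨S, hv, hS, by omega⟩⟩
  rintro H (hH | ⟨p, hp, -, rfl⟩)
  · simp only [Set.mem_insert_iff, Set.mem_singleton_iff] at hH
    rcases hH with rfl | rfl | rfl | rfl | rfl
    · exact key _ (starPendant_large _)
    · exact key _ (completePendant_large _ (by omega))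
    · exact path_large _ _ (by omega)
    · exact key _ (completeBip_large _ (by omega))
    · exact key _ (coupledComplete_large _ (by omega))
  · exact key _ (bistar_large _ p hp)

/-! ### The characterization of `B-IRS` -/

theorem familyLE_of_mem_boundedClass (F : Set FinGraph) (hF : F ∈ BoundedClass irs) :
    ∃ n : ℕ, 5 ≤ n ∧ FamilyLE F (irsFamily n) := by
  obtain ⟨c, hc⟩ := hF
  refine ⟨2 * c + 5, by omega, fun H hH => ?_⟩
  obtain ⟨hconn, hlarge⟩ := irsFamily_large c H hH
  by_contra hno
  -- A copy of `H` in the universe of the family.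
  let G : FinGraph := ⟨ULift H.V, inferInstance, H.graph.comap ULift.down⟩
  let e : G.graph ≃g H.graph := ⟨Equiv.ulift, Iff.rfl⟩
  have hG : G.graph.Connected := e.connected_iff.2 hconn
  have : Nonempty G.V := hG.nonempty
  refine (hc G hG fun ⟨H₁, h₁, h⟩ => hno ⟨H₁, h₁, h.trans ⟨e.toEmbedding⟩⟩).not_ge ?_
  exact (hlarge.of_iso e).le_irs

theorem mem_boundedClass_of_familyLE (F : Set FinGraph) {n : ℕ} (hn : 5 ≤ n)
    (hF : FamilyLE F (irsFamily n)) : F ∈ BoundedClass irs := by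
  obtain ⟨c, hc⟩ := exists_irsAt_lt n hn
  refine ⟨c, fun G hG hfree => ?_⟩
  obtain ⟨w, hw⟩ := hc hG fun H hH hHG => by
    obtain ⟨H₁, h₁, h⟩ := hF H hH
    exact hfree ⟨H₁, h₁, SimpleGraph.IsIndContained.trans h hHG⟩
  have : Nonempty G.V := hG.nonempty
  exact ((irs_isLeast G).2 ⟨w, rfl⟩).trans_lt hw

end DomRamsey

theorem mainTheorem4 (F : Set DomRamsey.FinGraph) :
    F ∈ DomRamsey.BoundedClass DomRamsey.irs ↔
      ∃ n : ℕ, 5 ≤ n ∧ DomRamsey.FamilyLE F (DomRamsey.irsFamily n) :=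
  ⟨DomRamsey.familyLE_of_mem_boundedClass F, fun ⟨_, hn, hF⟩ =>
    DomRamsey.mem_boundedClass_of_familyLE F hn hF⟩
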